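/- Let $b\ge 1$, let $U$ be a Clifford unitary on $b$ qubits (a unitary with $UPU^\dagger$ a Pauli operator for every Pauli operator $P\in\langle iI,\sigma_x,\sigma_y,\sigma_z\rangle^{\otimes b}$), and let $V:\mathbb{C}^2\to(\mathbb{C}^2)^{\otimes b}$, $V|\psi\rangle=U(|\psi\rangle\otimes|0\rangle^{\otimes(b-1)})$, be the corresponding encoder. Let $L_x,L_y,L_z\in\langle iI,\sigma_x,\sigma_y,\sigma_z\rangle^{\otimes b}$ be logical operators for it, i.e. $L_wV=V\sigma_w$ for $w\in\{x,y,z\}$. For $v,w\in\{x,y,z\}$ let $n(v\to w)$ be the number of qubits on which $L_v$ acts as $\sigma_w$ (up to a phase), let $D_{xyz}$ be the $3\times3$ matrix whose entry in row $w$ and column $v$ is $n(v\to w)$, let $\lambda_{\max}(D_{xyz})$ be its spectral radius, let $b_{\max}$ be the maximum of the weights of $L_x,L_y,L_z$ (the weight being the number of qubits on which an operator acts nontrivially), and let $$g_{xyz}(T)=\max_{w\in\{x,y,z\}}(1,1,1)\,D_{xyz}^T\,e_w ,$$ where $e_x,e_y,e_z$ is the standard basis. For $\epsilon\in[0,1]$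 let $\mathcal{M}_\epsilon(\rho)=(1-\epsilon)\rho+\epsilon\,\mathrm{tr}(\rho)\,I/2$ be the single-qubit depolarizing channel, and let $\mathcal{V}(\rho)=V\rho V^\dagger$. The noisy tree channel of depth $T\ge0$ is defined by $\mathcal{E}_0=\mathrm{id}$ and $$\mathcal{E}_{T+1}=\mathcal{M}_\epsilon^{\otimes b^{T+1}}\circ\mathcal{V}^{\otimes b^T}\circ\mathcal{E}_T ,$$ and the noiseless tree isometry is $V_T=V^{\otimes b^{T-1}}\cdots V^{\otimes b}V$. Let $L_w[T]$ be the Pauli operator on $b^T$ qubits obtained by concatenation: $L_w[0]=\sigma_w$, and $L_w[t+1]$ is obtained from $L_w[t]$ by replacing each tensor factor $\sigma_v$ by $L_v$ and each tensor factor $I$ by $I^{\otimes b}$ (keeping the global phase). Then: 1. For every $T\ge0$ and every single-qubit density operator $\rho$, $$\Big\|\mathcal{E}_T(\rho)-\mathcal{E}_T\Big(\frac I2\Big)\Big\|_1\le 2\sqrt2\,\sqrt{g_{xyz}(T)\,(1-\epsilon)^T},$$ where $\|\cdot\|_1$ is the trace norm. 2. For every $T\ge0$ and $w\in\{x,y,z\}$,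 the operator $L_w[T]$ is a logical $\sigma_w$ operator at level $T$, i.e. $L_w[T]V_T=V_T\sigma_w$, and its weight is at most $g_{xyz}(T)$; moreover $g_{xyz}(T)\le b_{\max}^T$. 3. If $(1-\epsilon)\min\{\lambda_{\max}(D_{xyz}),b_{\max}\}<1$, then in the limit $T\to\infty$ the output of $\mathcal{E}_T$ becomes independent of the input: $\sup_{\rho,\rho'}\|\mathcal{E}_T(\rho)-\mathcal{E}_T(\rho')\|_1\to0$ as $T\to\infty$, the supremum being over single-qubit density operators. -/

import Mathlib

open Matrix
open scoped ComplexOrder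

noncomputable section

namespace NoisyTree

/-! ### Qubits and Pauli operators -/

/-- The three nontrivial Pauli types `x, y, z`. -/
inductive Axis where
  | x : Axis
  | y : Axis
  | z : Axis
  deriving DecidableEq

instance : Fintype Axis :=
  ⟨{Axis.x, Axis.y, Axis.z}, fun w => by cases w <;> decide⟩

/-- A label of a single-qubit Pauli operator: `none` is the identity and `some w` is `σ_w`. -/
abbrev Label : Type := Option Axis

/-- Operators on a register of qubits labelled by `ι`; the computational basis of the register is
indexed by the bit strings `ι → Fin 2`. -/
abbrev Op (ι : Type) : Type := Matrix (ι → Fin 2) (ι → Fin 2) ℂ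

/-- Single-qubit operators. -/
abbrev Qubit : Type := Matrix (Fin 2) (Fin 2) ℂ

/-- The Pauli matrices `σ_x, σ_y, σ_z`. -/
def sigma : Axis → Qubit
  | Axis.x => !![0, 1; 1, 0]
  | Axis.y => !![0, -Complex.I; Complex.I, 0]
  | Axis.z => !![1, 0; 0, -1]

/-- The single-qubit operator with a given label. -/
def labelOp : Label → Qubit
  | none => 1
  | some w => sigma w

/-- An element of `⟨i I, σ_x, σ_y, σ_z⟩^{⊗ ι}`: the operator `i ^ phase • ⨂ k, σ_{label k}`. -/
structure PauliOp (ι : Type) where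
  /-- The exponent of the global phase `i ^ phase`. -/
  phase : Fin 4
  /-- The single-qubit Pauli operator on each qubit. -/
  label : ι → Label

/-- The matrix of a Pauli operator. -/
def PauliOp.toOp {ι : Type} [Fintype ι] (P : PauliOp ι) : Op ι :=
  Matrix.of fun r s => Complex.I ^ (P.phase : ℕ) * ∏ k, labelOp (P.label k) (r k) (s k)

/-- The weight of a Pauli operator: the number of qubits on which it acts nontrivially. -/
def PauliOp.weight {ι : Type} [Fintype ι] (P : PauliOp ι) : ℕ :=
  (Finset.univ.filter fun k => P.label k ≠ none).card

/-- The number of qubits on which a Pauli operator acts as `σ_w`. -/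
def PauliOp.count {ι : Type} [Fintype ι] (P : PauliOp ι) (w : Axis) : ℕ :=
  (Finset.univ.filter fun k => P.label k = some w).card

/-- `U` is a Clifford unitary: it is unitary and conjugates Pauli operators to Pauli operators. -/
def IsClifford {ι : Type} [Fintype ι] [DecidableEq ι] (U : Op ι) : Prop :=
  U ∈ Matrix.unitaryGroup (ι → Fin 2) ℂ ∧
    ∀ P : PauliOp ι, ∃ Q : PauliOp ι, U * P.toOp * Uᴴ = Q.toOp

/-- `L` is a logical `σ_w` operator for `V : ℂ² → (ℂ²)^{⊗ ι}`, that is, `L V = V σ_w`. -/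
def IsLogical {ι : Type} [Fintype ι] [DecidableEq ι] (V : Matrix (ι → Fin 2) (Fin 2) ℂ)
    (L : PauliOp ι) (w : Axis) : Prop :=
  L.toOp * V = V * sigma w

/-! ### The encoder and the tree -/

/-- The encoder `V |ψ⟩ = U (|ψ⟩ ⊗ |0⟩^{⊗ (b-1)})`; the data qubit is qubit number `0`. -/
def encoder {b : ℕ} (U : Op (Fin b)) : Matrix (Fin b → Fin 2) (Fin 2) ℂ :=
  Matrix.of fun r a => U r (fun k => if (k : ℕ) = 0 then a else 0)

/-- The `b ^ t` nodes at level `t` of the full `b`-ary tree, as paths from the root. -/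
abbrev Node (b t : ℕ) : Type := Fin t → Fin b

/-- The `c`-th child of the node `v`. -/
def child {b t : ℕ} (v : Node b t) (c : Fin b) : Node b (t + 1) :=
  Fin.snoc (α := fun _ => Fin b) v c

/-- `V^{⊗ b^t}`, which maps the qubits of level `t` to the qubits of level `t + 1`: the qubit at
node `v` is encoded into the qubits at the children of `v`. -/
def layer {b : ℕ} (V : Matrix (Fin b → Fin 2) (Fin 2) ℂ) (t : ℕ) :
    Matrix (Node b (t + 1) → Fin 2) (Node b t → Fin 2) ℂ :=
  Matrix.of fun r s => ∏ v : Node b t, V (fun c => r (child v c)) (s v)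

/-- The noiseless tree isometry `V_T = V^{⊗ b^{T-1}} ⋯ V^{⊗ b} V`. -/
def treeIsometry {b : ℕ} (V : Matrix (Fin b → Fin 2) (Fin 2) ℂ) :
    (T : ℕ) → Matrix (Node b T → Fin 2) (Fin 2) ℂ
  | 0 => Matrix.of fun r a => if r Fin.elim0 = a then 1 else 0
  | T + 1 => layer V T * treeIsometry V T

/-- The depolarizing channel `M_ε(ρ) = (1 - ε) ρ + ε tr(ρ) I / 2`. -/
def depolarizing (ε : ℝ) : Qubit →ₗ[ℂ] Qubit :=
  ((1 - ε : ℝ) : ℂ) • LinearMap.id +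
    ((ε / 2 : ℝ) : ℂ) • (Matrix.traceLinearMap (Fin 2) ℂ ℂ).smulRight (1 : Qubit)

/-- The tensor power `Φ^{⊗ ι}` of a single-qubit superoperator, obtained by expanding the argument
in the matrix units `⨂ k, |r k⟩⟨s k|`. -/
def tensorPower {ι : Type} [Fintype ι] [DecidableEq ι] (Φ : Qubit →ₗ[ℂ] Qubit) (A : Op ι) : Op ι :=
  Matrix.of fun p q => ∑ r : ι → Fin 2, ∑ s : ι → Fin 2,
    A r s * ∏ k, Φ (Matrix.single (r k) (s k) 1) (p k) (q k)

/-- The noisy tree channel `E_T`, with `E_0` the identity (up to naming the root qubit) and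
`E_{T+1} = N^{⊗ b^{T+1}} ∘ 𝒱^{⊗ b^T} ∘ E_T`. There is no noise at the root. -/
def treeChannel {b : ℕ} (V : Matrix (Fin b → Fin 2) (Fin 2) ℂ) (N : Qubit →ₗ[ℂ] Qubit) :
    (T : ℕ) → Qubit → Op (Node b T)
  | 0, ρ => ρ.submatrix (fun r => r Fin.elim0) (fun r => r Fin.elim0)
  | T + 1, ρ => tensorPower N (layer V T * treeChannel V N T ρ * (layer V T)ᴴ)

/-! ### States and the trace norm -/

/-- Single-qubit density operators. -/
def IsDensity (ρ : Qubit) : Prop := ρ.PosSemidef ∧ ρ.trace = 1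

/-- The maximally mixed state `I / 2`. -/
def maxMixed : Qubit := (1 / 2 : ℂ) • (1 : Qubit)

/-- The trace norm `‖A‖₁ = tr √(A† A)`, the sum of the singular values of `A`. -/
def traceNorm {n : Type} [Fintype n] [DecidableEq n] (A : Matrix n n ℂ) : ℝ :=
  ∑ i, √((Matrix.isHermitian_conjTranspose_mul_self A).eigenvalues i)

/-! ### Weight transitions of the logical operators -/

/-- The weight transition matrix: its entry in row `w` and column `v` is `n(v → w)`, the number of
qubits on which the logical `σ_v` acts as `σ_w`. -/
def transitionMatrix {b : ℕ} (L : Axis → PauliOp (Fin b)) : Matrix Axis Axis ℕ :=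
  Matrix.of fun w v => (L v).count w

/-- `b_max`, the maximum weight of the three logical operators. -/
def bMax {b : ℕ} (L : Axis → PauliOp (Fin b)) : ℕ :=
  Finset.univ.sup fun w => (L w).weight

/-- `g(T) = max_w (1,1,1) D^T e_w`. -/
def gWeight {b : ℕ} (L : Axis → PauliOp (Fin b)) (T : ℕ) : ℕ :=
  Finset.univ.sup fun w : Axis => (fun _ : Axis => 1) ⬝ᵥ (transitionMatrix L ^ T *ᵥ Pi.single w 1)

/-- The spectral radius of the weight transition matrix (largest modulus of a complex
eigenvalue). -/
def lambdaMax {b : ℕ} (L : Axis → PauliOp (Fin b)) : ℝ :=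
  (spectralRadius ℂ ((transitionMatrix L).map (Nat.cast : ℕ → ℂ))).toReal

/-- The operators `L_w`, extended by the logical identity `L_0 = I^{⊗ b}`. -/
def extendLogical {b : ℕ} (L : Axis → PauliOp (Fin b)) : Label → PauliOp (Fin b)
  | none => ⟨0, fun _ => none⟩
  | some w => L w

/-- The logical operator `L_w[T]` at level `T`, obtained by concatenation: `L_w[0] = σ_w`, and
`L_w[t+1]` arises from `L_w[t]` by replacing each tensor factor `σ_v` by `L_v`. -/
def levelLogical {b : ℕ} (L : Axis → PauliOp (Fin b)) (w : Axis) :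
    (T : ℕ) → PauliOp (Node b T)
  | 0 => ⟨0, fun _ => some w⟩
  | T + 1 =>
    ⟨(levelLogical L w T).phase +
        ∑ v : Node b T, (extendLogical L ((levelLogical L w T).label v)).phase,
      fun u => (extendLogical L ((levelLogical L w T).label (Fin.init u))).label (u (Fin.last T))⟩

end NoisyTree

end

open NoisyTree

/-! The argument runs backwards through the tree, from the leaves to the root, and tracks how
strongly the remaining channel reacts to a Pauli operator on its input. `SensitivityBound R c` says
that conjugating a positive input by a Pauli operator moves the output of `R` by at most the sum of
a cost `c v` over the factors `σ_v`, times the trace of the input. The identity channel has all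
costs equal to 2.

Two facts propagate such costs. Depolarizing one qubit averages its input with its full Pauli twirl,
and the twirl does not see a Pauli operator on that qubit; so noise in front of `R` multiplies costs
by `1 - ε` (`SensitivityBound.comp_noiseMap`, one site at a time). An encoding layer turns each
`σ_v` into `L v` on the children; so a layer in front of `R` replaces the row vector `c` by `c D`,
with `D` the transition matrix (`SensitivityBound.comp_layer`). After `T` levels the cost of `σ_w`
at the root is `2 (1-ε)^T (1,1,1) D^T e_w`, at most `2x` for `x = g(T) (1-ε)^T`.

Since `I/2` is the average of `ρ` over conjugation by the four Pauli matrices, the distance to the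
output of `I/2` is at most `3x/2`. Together with the trivial bound 2 this gives the stated square
root bound. The linear bound also settles the limit: `x → 0` follows from Gelfand's formula for `D`,
or from `g(T) ≤ b_max^T`. The weight claims use the same recursion with unit costs.

Distances are carried by decompositions into positive parts (`HasTraceBound`), which add without a
triangle inequality for the trace norm. -/

noncomputable section

namespace NoisyTree

/-! ### Trace norm bounds from positive decompositions -/

section TraceBound

variable {n : Type} [Fintype n]

/-- `A` is a difference of positive operators whose traces add up to at most `c`. -/
def HasTraceBound (A : Matrix n n ℂ) (c : ℝ) : Prop :=
  ∃ P N : Matrix n n ℂ, P.PosSemidef ∧ N.PosSemidef ∧ A = P - N ∧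
    P.trace.re + N.trace.re ≤ c

lemma HasTraceBound.mono {A : Matrix n n ℂ} {c d : ℝ} (h : HasTraceBound A c) (hcd : c ≤ d) :
    HasTraceBound A d := by
  obtain ⟨P, N, hP, hN, hA, hc⟩ := h
  exact ⟨P, N, hP, hN, hA, hc.trans hcd⟩

lemma HasTraceBound.congr {A B : Matrix n n ℂ} {c d : ℝ} (h : HasTraceBound A c) (hA : A = B)
    (hc : c = d) : HasTraceBound B d := hA ▸ hc ▸ h

lemma HasTraceBound.zero : HasTraceBound (0 : Matrix n n ℂ) 0 :=
  ⟨0, 0, PosSemidef.zero, PosSemidef.zero, by simp, by simp⟩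

lemma HasTraceBound.add {A B : Matrix n n ℂ} {c d : ℝ} (hA : HasTraceBound A c)
    (hB : HasTraceBound B d) : HasTraceBound (A + B) (c + d) := by
  obtain ⟨P, N, hP, hN, rfl, hc⟩ := hA
  obtain ⟨P', N', hP', hN', rfl, hd⟩ := hB
  refine ⟨P + P', N + N', hP.add hP', hN.add hN', by abel, ?_⟩
  simp only [trace_add, Complex.add_re]
  linarith

lemma HasTraceBound.neg {A : Matrix n n ℂ} {c : ℝ} (hA : HasTraceBound A c) :
    HasTraceBound (-A) c := by
  obtain ⟨P, N, hP, hN, rfl, hc⟩ := hA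
  exact ⟨N, P, hN, hP, by abel, by linarith⟩

lemma HasTraceBound.smul {A : Matrix n n ℂ} {c : ℝ} (hA : HasTraceBound A c) {a : ℝ}
    (ha : 0 ≤ a) : HasTraceBound ((a : ℂ) • A) (a * c) := by
  obtain ⟨P, N, hP, hN, rfl, hc⟩ := hA
  have ha' : (0 : ℂ) ≤ (a : ℂ) := by exact_mod_cast ha
  refine ⟨(a : ℂ) • P, (a : ℂ) • N, hP.smul ha', hN.smul ha', by rw [smul_sub], ?_⟩
  simp only [trace_smul, smul_eq_mul, Complex.re_ofReal_mul]
  nlinarith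

lemma HasTraceBound.sum {ι : Type} (s : Finset ι) {A : ι → Matrix n n ℂ} {c : ι → ℝ}
    (h : ∀ i ∈ s, HasTraceBound (A i) (c i)) :
    HasTraceBound (∑ i ∈ s, A i) (∑ i ∈ s, c i) := by
  classical
  induction s using Finset.induction_on with
  | empty => simpa using HasTraceBound.zero
  | insert i s hi ih =>
    rw [Finset.sum_insert hi, Finset.sum_insert hi]
    exact (h i (Finset.mem_insert_self i s)).add
      (ih fun j hj => h j (Finset.mem_insert_of_mem hj))

lemma HasTraceBound.sub_of_posSemidef {P N : Matrix n n ℂ} (hP : P.PosSemidef)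
    (hN : N.PosSemidef) : HasTraceBound (P - N) (P.trace.re + N.trace.re) :=
  ⟨P, N, hP, hN, rfl, le_rfl⟩

/-- The trace norm of a Hermitian matrix is the sum of the moduli of its eigenvalues. -/
lemma traceNorm_eq_sum_abs_eigenvalues [DecidableEq n] {A : Matrix n n ℂ} (hA : A.IsHermitian) :
    traceNorm A = ∑ i, |hA.eigenvalues i| := by
  have hB := isHermitian_conjTranspose_mul_self A
  -- The eigenvalues of `Aᴴ * A` and the squared eigenvalues of `A` come in unrelated enumerations,
  -- so they are compared as multisets of roots of one characteristic polynomial.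
  have hroots : (Aᴴ * A).charpoly.roots =
      Finset.univ.val.map fun i => ((hA.eigenvalues i ^ 2 : ℝ) : ℂ) := by
    have h1 : Aᴴ * A = (hA.eigenvectorUnitary : Matrix n n ℂ) *
        diagonal (fun i => ((hA.eigenvalues i ^ 2 : ℝ) : ℂ)) *
        (star hA.eigenvectorUnitary : Matrix n n ℂ) := by
      have h2 := hA.spectral_theorem
      rw [Unitary.conjStarAlgAut_apply] at h2
      have h3 : (star hA.eigenvectorUnitary : Matrix n n ℂ) *
        (hA.eigenvectorUnitary : Matrix n n ℂ) = 1 := Unitary.coe_star_mul_self _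
      rw [hA.eq]
      conv_lhs => rw [h2]
      have h4 : ∀ X D Y : Matrix n n ℂ, Y * X = 1 → (X * D * Y) * (X * D * Y) = X * (D * D) * Y := by
        intro X D Y h
        calc (X * D * Y) * (X * D * Y) = X * D * (Y * X) * D * Y := by simp only [Matrix.mul_assoc]
          _ = _ := by rw [h]; simp only [Matrix.mul_assoc, Matrix.one_mul]
      rw [h4 _ _ _ h3, diagonal_mul_diagonal]
      congr 3
      ext i
      simp [sq]
    have h5 : (Aᴴ * A).charpoly = ∏ i, (Polynomial.X -
        Polynomial.C ((hA.eigenvalues i ^ 2 : ℝ) : ℂ)) := by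
      rw [h1, ← charpoly_diagonal, Matrix.charpoly_mul_comm, ← Matrix.mul_assoc,
        Unitary.coe_star_mul_self, Matrix.one_mul]
    rw [h5, Polynomial.roots_prod _ _ (Finset.prod_ne_zero_iff.2 fun i _ => Polynomial.X_sub_C_ne_zero _)]
    simp only [Polynomial.roots_X_sub_C, Multiset.bind_singleton]
  have hroots' := hB.roots_charpoly_eq_eigenvalues
  rw [hroots] at hroots'
  have := congrArg (fun s : Multiset ℂ => (s.map fun z => √z.re).sum) hroots'
  simp only [Multiset.map_map, Function.comp_def, Complex.ofReal_re, Real.sqrt_sq_eq_abs] at this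
  exact this.symm

/-- A difference of positive operators has trace norm at most the sum of their traces. -/
lemma HasTraceBound.traceNorm_le [DecidableEq n] {A : Matrix n n ℂ} {c : ℝ} (h : HasTraceBound A c) :
    traceNorm A ≤ c := by
  obtain ⟨P, N, hP, hN, rfl, hc⟩ := h
  have hA : (P - N).IsHermitian := hP.1.sub hN.1
  rw [traceNorm_eq_sum_abs_eigenvalues hA]
  refine le_trans ?_ hc
  -- In an eigenbasis of `P - N` each eigenvalue is a difference of diagonal entries of `P` and `N`,
  -- which are nonnegative and sum to the two traces.
  set W : Matrix n n ℂ := (hA.eigenvectorUnitary : Matrix n n ℂ) with hW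
  have htr : ∀ M : Matrix n n ℂ, M.trace.re = ∑ i, ((Wᴴ * M * W) i i).re := by
    intro M
    have : (Wᴴ * M * W).trace = M.trace := by
      rw [Matrix.trace_mul_comm, ← Matrix.mul_assoc]
      have : W * Wᴴ = 1 := Unitary.coe_mul_star_self hA.eigenvectorUnitary
      rw [this, Matrix.one_mul]
    rw [← this, Matrix.trace, Complex.re_sum]
    rfl
  have hdiag : Wᴴ * (P - N) * W = diagonal (fun i => (hA.eigenvalues i : ℂ)) := by
    have h2 := hA.spectral_theorem
    rw [Unitary.conjStarAlgAut_apply] at h2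
    have h3 : Wᴴ * W = 1 := Unitary.coe_star_mul_self hA.eigenvectorUnitary
    conv_lhs => rw [h2]
    have h4 : ∀ D : Matrix n n ℂ, Wᴴ * (W * D * Wᴴ) * W = D := by
      intro D
      calc Wᴴ * (W * D * Wᴴ) * W = (Wᴴ * W) * D * (Wᴴ * W) := by simp only [Matrix.mul_assoc]
        _ = D := by rw [h3, Matrix.one_mul, Matrix.mul_one]
    exact h4 _
  rw [htr P, htr N, ← Finset.sum_add_distrib]
  refine Finset.sum_le_sum fun i _ => ?_
  have hi : hA.eigenvalues i = ((Wᴴ * P * W) i i).re - ((Wᴴ * N * W) i i).re := by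
    have := congrFun (congrFun hdiag i) i
    rw [Matrix.mul_sub, Matrix.sub_mul, Matrix.sub_apply, diagonal_apply_eq] at this
    have := congrArg Complex.re this
    simpa using this.symm
  have hpos : ∀ M : Matrix n n ℂ, M.PosSemidef → 0 ≤ ((Wᴴ * M * W) i i).re := by
    intro M hM
    exact (Complex.le_def.1 ((hM.conjTranspose_mul_mul_same W).diag_nonneg (i := i))).1
  have h1 := hpos P hP
  have h2 := hpos N hN
  rw [hi, abs_le]
  constructor <;> linarith

end TraceBound

/-! ### Conjugation and products of single-qubit operators -/

section Conj

variable {n m l : Type} [Fintype n]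

/-- The map `A ↦ K A K†`. -/
def conjMap (K : Matrix m n ℂ) : Matrix n n ℂ →ₗ[ℂ] Matrix m m ℂ where
  toFun A := K * A * Kᴴ
  map_add' A B := by rw [Matrix.mul_add, Matrix.add_mul]
  map_smul' a A := by simp

lemma conjMap_apply (K : Matrix m n ℂ) (A : Matrix n n ℂ) : conjMap K A = K * A * Kᴴ := rfl

lemma conjMap_mul [Fintype m] (K : Matrix l m ℂ) (K' : Matrix m n ℂ) (A : Matrix n n ℂ) :
    conjMap (K * K') A = conjMap K (conjMap K' A) := by
  simp only [conjMap_apply, conjTranspose_mul, Matrix.mul_assoc]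

lemma conjMap_smul (a : ℂ) (ha : a * star a = 1) (K : Matrix m n ℂ) :
    conjMap (a • K) = conjMap K := by
  ext1 A
  simp only [conjMap_apply, conjTranspose_smul, Matrix.smul_mul, Matrix.mul_smul, smul_smul]
  rw [mul_comm, ha, one_smul]

lemma conjMap_posSemidef [Fintype m] (K : Matrix m n ℂ) {A : Matrix n n ℂ} (hA : A.PosSemidef) :
    (conjMap K A).PosSemidef :=
  hA.mul_mul_conjTranspose_same K

lemma conjMap_trace [Fintype m] [DecidableEq n] {K : Matrix m n ℂ} (hK : Kᴴ * K = 1) (A : Matrix n n ℂ) :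
    (conjMap K A).trace = A.trace := by
  rw [conjMap_apply, Matrix.trace_mul_comm, ← Matrix.mul_assoc, hK, Matrix.one_mul]

end Conj

/-! ### Tensor products and Pauli operators up to phase. -/

section Tens

variable {ι : Type} [Fintype ι]

/-- The tensor product of a family of single-qubit operators. -/
def tens (K : ι → Qubit) : Op ι := Matrix.of fun r s => ∏ k, K k (r k) (s k)

lemma tens_mul [DecidableEq ι] (K K' : ι → Qubit) :
    tens K * tens K' = tens fun k => K k * K' k := by
  ext r s
  simp only [tens, Matrix.mul_apply, Matrix.of_apply, ← Finset.prod_mul_distrib]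
  rw [Finset.prod_univ_sum, Fintype.piFinset_univ]

lemma tens_conjTranspose (K : ι → Qubit) : (tens K)ᴴ = tens fun k => (K k)ᴴ := by
  ext r s
  simp [tens, conjTranspose_apply]

lemma tens_one : tens (fun _ : ι => (1 : Qubit)) = 1 := by
  classical
  ext r s
  simp only [tens, Matrix.of_apply, Matrix.one_apply]
  rw [Fintype.prod_boole]
  simp [funext_iff]

lemma labelOp_conjTranspose (l : Label) : (labelOp l)ᴴ = labelOp l := by
  rcases l with _ | w
  · simp [labelOp]
  · cases w <;> ext i j <;> fin_cases i <;> fin_cases j <;>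
      simp [labelOp, sigma, conjTranspose_apply]

lemma labelOp_mul_self (l : Label) : labelOp l * labelOp l = 1 := by
  rcases l with _ | w
  · simp [labelOp]
  · cases w <;> ext i j <;> fin_cases i <;> fin_cases j <;>
      simp [labelOp, sigma, Matrix.mul_apply, Fin.sum_univ_two]

/-- The tensor product of Pauli operators with given labels. -/
def pauli (f : ι → Label) : Op ι := tens fun k => labelOp (f k)

lemma pauli_conjTranspose (f : ι → Label) : (pauli f)ᴴ = pauli f := by
  simp [pauli, tens_conjTranspose, labelOp_conjTranspose]

lemma pauli_conjTranspose_mul_self [DecidableEq ι] (f : ι → Label) :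
    (pauli f)ᴴ * pauli f = 1 := by
  rw [pauli_conjTranspose, pauli, tens_mul]
  simp [labelOp_mul_self, tens_one]

lemma pauli_none [DecidableEq ι] : pauli (fun _ : ι => none) = 1 := by
  simp [pauli, labelOp, tens_one]

lemma PauliOp.toOp_eq_smul (P : PauliOp ι) :
    P.toOp = Complex.I ^ (P.phase : ℕ) • pauli P.label := by
  ext r s
  simp [PauliOp.toOp, pauli, tens]

lemma conjMap_toOp [DecidableEq ι] (P : PauliOp ι) : conjMap P.toOp = conjMap (pauli P.label) := by
  rw [PauliOp.toOp_eq_smul]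
  refine conjMap_smul _ ?_ _
  rw [star_pow, ← mul_pow]
  simp

/-- Pauli operators multiply, up to a phase, like the Klein four-group. -/
def Label.mul : Label → Label → Label
  | none, l => l
  | l, none => l
  | some Axis.x, some Axis.x => none
  | some Axis.x, some Axis.y => some Axis.z
  | some Axis.x, some Axis.z => some Axis.y
  | some Axis.y, some Axis.x => some Axis.z
  | some Axis.y, some Axis.y => none
  | some Axis.y, some Axis.z => some Axis.x
  | some Axis.z, some Axis.x => some Axis.y
  | some Axis.z, some Axis.y => some Axis.x
  | some Axis.z, some Axis.z => none

/-- Only the modulus of the phase matters, because conjugation cancels a unimodular scalar. -/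
lemma labelOp_mul (l l' : Label) : ∃ a : ℂ, a * star a = 1 ∧
    labelOp l * labelOp l' = a • labelOp (Label.mul l l') := by
  rcases l with _ | w
  · exact ⟨1, by simp, by simp [labelOp, Label.mul]⟩
  rcases l' with _ | w'
  · exact ⟨1, by simp, by cases w <;> simp [labelOp, Label.mul]⟩
  by_cases h : w = w'
  · subst h
    exact ⟨1, by simp, by rw [labelOp_mul_self]; cases w <;> simp [labelOp, Label.mul]⟩
  have hcases : labelOp (some w) * labelOp (some w') =
        Complex.I • labelOp (Label.mul (some w) (some w')) ∨
      labelOp (some w) * labelOp (some w') =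
        (-Complex.I) • labelOp (Label.mul (some w) (some w')) := by
    cases w <;> cases w' <;> first
      | exact absurd rfl h
      | (left; ext i j; fin_cases i <;> fin_cases j <;>
          simp [labelOp, sigma, Label.mul, Matrix.mul_apply, Fin.sum_univ_two]; done)
      | (right; ext i j; fin_cases i <;> fin_cases j <;>
          simp [labelOp, sigma, Label.mul, Matrix.mul_apply, Fin.sum_univ_two])
  rcases hcases with h | h
  · exact ⟨_, by simp, h⟩
  · exact ⟨_, by simp, h⟩

lemma Label.mul_comm (l l' : Label) : Label.mul l l' = Label.mul l' l := by
  rcases l with _ | w <;> rcases l' with _ | w'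
  · rfl
  · cases w' <;> rfl
  · cases w <;> rfl
  · cases w <;> cases w' <;> rfl

lemma conjMap_pauli_mul [DecidableEq ι] (f g : ι → Label) (A : Op ι) :
    conjMap (pauli f) (conjMap (pauli g) A) =
      conjMap (pauli fun k => Label.mul (f k) (g k)) A := by
  choose a ha hmul using labelOp_mul
  have : pauli f * pauli g =
      (∏ k, a (f k) (g k)) • pauli fun k => Label.mul (f k) (g k) := by
    simp only [pauli, tens_mul]
    ext r s
    rw [Matrix.smul_apply, smul_eq_mul]
    simp only [tens, of_apply]
    rw [← Finset.prod_mul_distrib]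
    refine Finset.prod_congr rfl fun k _ => ?_
    rw [hmul (f k) (g k), Matrix.smul_apply, smul_eq_mul]
  rw [← conjMap_mul, this, conjMap_smul]
  rw [star_prod, ← Finset.prod_mul_distrib]
  exact Finset.prod_eq_one fun k _ => ha _ _

/-- Pauli operators commute up to sign, and conjugation erases the sign. -/
lemma conjMap_pauli_comm [DecidableEq ι] (f g : ι → Label) (A : Op ι) :
    conjMap (pauli f) (conjMap (pauli g) A) = conjMap (pauli g) (conjMap (pauli f) A) := by
  simp only [conjMap_pauli_mul, Label.mul_comm]

/-- Splitting off the factor at one site. -/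
lemma pauli_update_mul [DecidableEq ι] (f : ι → Label) (k : ι) (l : Label) (hk : f k = none) :
    pauli (Function.update f k l) = pauli (Function.update (fun _ => none) k l) * pauli f := by
  simp only [pauli, tens_mul]
  congr 1
  ext1 j
  by_cases hj : j = k
  · subst hj; simp [hk, labelOp]
  · simp [hj, labelOp]

end Tens

/-! ### Depolarizing noise as a mixture of Pauli errors -/

section Noise

variable {ι : Type} [Fintype ι] [DecidableEq ι]

/-- The probability of each Pauli error under depolarizing noise. -/
def errorProb (ε : ℝ) : Label → ℝ
  | none => 1 - 3 * ε / 4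
  | some _ => ε / 4

lemma Label.sum_eq {M : Type} [AddCommMonoid M] (F : Label → M) :
    ∑ l, F l = F none + (F (some Axis.x) + (F (some Axis.y) + F (some Axis.z))) := by
  rw [Fintype.sum_option]
  congr 1
  change ∑ w ∈ {Axis.x, Axis.y, Axis.z}, F (some w) = _
  rw [Finset.sum_insert (by decide), Finset.sum_insert (by decide), Finset.sum_singleton]

lemma errorProb_nonneg {ε : ℝ} (hε0 : 0 ≤ ε) (hε1 : ε ≤ 1) (l : Label) : 0 ≤ errorProb ε l := by
  cases l <;> simp only [errorProb] <;> linarith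

lemma errorProb_sum (ε : ℝ) : ∑ l, errorProb ε l = 1 := by
  rw [Label.sum_eq]; simp only [errorProb]; ring

/-- Independent random Pauli errors with the distribution `errorProb ε` on every qubit. -/
def noiseMap (ε : ℝ) : Op ι →ₗ[ℂ] Op ι :=
  ∑ f : ι → Label, ((∏ k, errorProb ε (f k) : ℝ) : ℂ) • conjMap (pauli f)

lemma noiseMap_apply (ε : ℝ) (A : Op ι) : noiseMap ε A =
    ∑ f : ι → Label, ((∏ k, errorProb ε (f k) : ℝ) : ℂ) • conjMap (pauli f) A := by
  simp [noiseMap]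

/-- The replacement term `tr(A) I / 2` is the uniform average of `A` over the four Pauli
conjugations, so the identity receives `1 - ε + ε/4`. -/
lemma depolarizing_eq_sum (ε : ℝ) (A : Qubit) :
    depolarizing ε A =
      ∑ l, (errorProb ε l : ℂ) • (labelOp l * A * (labelOp l)ᴴ) := by
  rw [Label.sum_eq]
  simp only [labelOp_conjTranspose]
  obtain ⟨a, b, c, d, rfl⟩ : ∃ a b c d, A = !![a, b; c, d] := ⟨_, _, _, _, eta_fin_two A⟩
  ext i j
  fin_cases i <;> fin_cases j <;>
    simp [depolarizing, errorProb, labelOp, sigma, Fin.sum_univ_two, Matrix.trace] <;> ring_nf <;> simp <;> ring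

lemma tensorPower_depolarizing (ε : ℝ) (A : Op ι) :
    tensorPower (depolarizing ε) A = noiseMap ε A := by
  have hsingle : ∀ a b p q : Fin 2, depolarizing ε (Matrix.single a b 1) p q =
      ∑ l, (errorProb ε l : ℂ) * (labelOp l p a * star (labelOp l q b)) := by
    intro a b p q
    rw [depolarizing_eq_sum, Matrix.sum_apply]
    refine Finset.sum_congr rfl fun l _ => ?_
    simp [Matrix.mul_apply, Matrix.single_apply, Finset.sum_ite_eq, ite_and]
  ext p q
  simp only [tensorPower, of_apply, hsingle]
  rw [noiseMap_apply, Matrix.sum_apply]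
  simp only [Matrix.smul_apply, conjMap_apply, Matrix.mul_apply, smul_eq_mul,
    Finset.prod_univ_sum, Fintype.piFinset_univ, Finset.mul_sum, Finset.sum_mul]
  rw [Finset.sum_comm' (s := Finset.univ) (t := fun _ => Finset.univ) (t' := Finset.univ)
    (s' := fun _ => Finset.univ) (by simp)]
  rw [Finset.sum_congr rfl fun s _ => Finset.sum_comm, Finset.sum_comm]
  refine Finset.sum_congr rfl fun f _ => Finset.sum_congr rfl fun s _ =>
    Finset.sum_congr rfl fun r _ => ?_
  simp only [pauli, tens, of_apply, conjTranspose_apply, star_prod, Finset.prod_mul_distrib,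
    Complex.ofReal_prod]
  ring

/-- The noise on all qubits but `k`. -/
def noiseOff (ε : ℝ) (k : ι) (A : Op ι) : Op ι :=
  ∑ g : {j // j ≠ k} → Label, ((∏ j, errorProb ε (g j) : ℝ) : ℂ) •
    conjMap (pauli ((Equiv.funSplitAt k Label).symm (none, g))) A

/-- A Pauli operator acting on the single qubit `k`. -/
def sitePauli (k : ι) (l : Label) : Op ι := pauli (Function.update (fun _ => none) k l)

/-- Errors on different qubits are independent, so the error at `k` can be drawn last. -/
lemma noiseMap_eq_noiseOff (ε : ℝ) (k : ι) (A : Op ι) : noiseMap ε A =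
    ∑ l, (errorProb ε l : ℂ) • conjMap (sitePauli k l) (noiseOff ε k A) := by
  rw [noiseMap_apply, ← (Equiv.funSplitAt k Label).symm.sum_comp, Fintype.sum_prod_type]
  refine Finset.sum_congr rfl fun l _ => ?_
  simp only [noiseOff, map_sum, map_smul, Finset.smul_sum, smul_smul]
  refine Finset.sum_congr rfl fun g _ => ?_
  have hupd : (Equiv.funSplitAt k Label).symm (l, g) =
      Function.update ((Equiv.funSplitAt k Label).symm (none, g)) k l := by
    ext1 j
    by_cases hj : j = k
    · subst hj; simp
    · simp [hj]
  congr 1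
  · rw [← Complex.ofReal_mul, ← Fintype.prod_subtype_mul_prod_subtype (fun j => j = k)]
    congr 2
    · have h := (default : {j // j = k}).2
      simp [h]
    · refine Finset.prod_congr rfl fun j _ => ?_
      simp [j.2]
  · rw [hupd, pauli_update_mul _ _ _ (by simp), conjMap_mul, sitePauli]

lemma posSemidef_trace_mixture {κ : Type} [Fintype κ] (p : κ → ℝ) (hp : ∀ i, 0 ≤ p i)
    (hp1 : ∑ i, p i = 1) (f : κ → ι → Label) {A : Op ι} (hA : A.PosSemidef) :
    (∑ i, (p i : ℂ) • conjMap (pauli (f i)) A).PosSemidef ∧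
      (∑ i, (p i : ℂ) • conjMap (pauli (f i)) A).trace = A.trace := by
  constructor
  · refine posSemidef_sum _ fun i _ => (conjMap_posSemidef _ hA).smul ?_
    exact_mod_cast hp i
  · simp only [trace_sum, trace_smul, conjMap_trace (pauli_conjTranspose_mul_self _),
      ← Finset.sum_smul, ← Complex.ofReal_sum, hp1]
    simp

lemma prod_errorProb_sum (ε : ℝ) (κ : Type) [Fintype κ] [DecidableEq κ] :
    ∑ f : κ → Label, ∏ k, errorProb ε (f k) = 1 := by
  rw [← Fintype.piFinset_univ, ← Finset.prod_univ_sum]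
  simp only [errorProb_sum, Finset.prod_const_one]

lemma noiseMap_posSemidef_trace {ε : ℝ} (hε0 : 0 ≤ ε) (hε1 : ε ≤ 1) {A : Op ι}
    (hA : A.PosSemidef) : (noiseMap ε A).PosSemidef ∧ (noiseMap ε A).trace = A.trace := by
  rw [noiseMap_apply]
  exact posSemidef_trace_mixture _
    (fun _ => Finset.prod_nonneg fun _ _ => errorProb_nonneg hε0 hε1 _)
    (prod_errorProb_sum ε ι) _ hA

lemma noiseOff_posSemidef_trace {ε : ℝ} (hε0 : 0 ≤ ε) (hε1 : ε ≤ 1) (k : ι) {A : Op ι}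
    (hA : A.PosSemidef) :
    (noiseOff ε k A).PosSemidef ∧ (noiseOff ε k A).trace = A.trace :=
  posSemidef_trace_mixture _
    (fun _ => Finset.prod_nonneg fun _ _ => errorProb_nonneg hε0 hε1 _)
    (prod_errorProb_sum ε _) _ hA

lemma conjMap_sitePauli_mul (k : ι) (l l' : Label) (A : Op ι) :
    conjMap (sitePauli k l) (conjMap (sitePauli k l') A) =
      conjMap (sitePauli k (Label.mul l l')) A := by
  simp only [sitePauli, conjMap_pauli_mul]
  congr 3
  ext1 j
  by_cases hj : j = k
  · subst hj; simp
  · simp [hj, Label.mul]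

lemma conjMap_sitePauli_none (k : ι) (A : Op ι) : conjMap (sitePauli k none) A = A := by
  have : sitePauli k none = (1 : Op ι) := by
    rw [sitePauli, Function.update_eq_self_iff.2 rfl, pauli_none]
  simp [this, conjMap_apply]

lemma noiseMap_conjMap_pauli (ε : ℝ) (f : ι → Label) (A : Op ι) :
    noiseMap ε (conjMap (pauli f) A) = conjMap (pauli f) (noiseMap ε A) := by
  simp only [noiseMap_apply, map_sum, map_smul]
  refine Finset.sum_congr rfl fun g _ => ?_
  rw [conjMap_pauli_comm]

/-- Depolarizing noise attenuates the effect of a Pauli operator on one qubit by `1 - ε`. -/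
lemma noiseMap_conjMap_sitePauli_sub (ε : ℝ) (k : ι) (l : Label) (A : Op ι) :
    noiseMap ε (conjMap (sitePauli k l) A) - noiseMap ε A =
      ((1 - ε : ℝ) : ℂ) • (conjMap (sitePauli k l) (noiseOff ε k A) - noiseOff ε k A) := by
  rw [sitePauli, noiseMap_conjMap_pauli, ← sitePauli, noiseMap_eq_noiseOff ε k]
  simp only [map_sum, map_smul, conjMap_sitePauli_mul]
  -- Multiplication by `w` exchanges `none` with `w` and the other two labels with each other. Those
  -- two are equally likely and cancel; what remains has coefficient `(1 - 3ε/4) - ε/4 = 1 - ε`.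
  simp only [Label.sum_eq]
  rcases l with _ | w
  · simp [Label.mul, conjMap_sitePauli_none]
  · cases w <;> simp only [Label.mul, conjMap_sitePauli_none, errorProb] <;> push_cast <;> module

end Noise

/-! ### The encoding layers -/

section Layer

variable {b : ℕ}

/-- The nodes at level `t + 1` are the children of the nodes at level `t`. -/
def childEquiv (b t : ℕ) : Node b t × Fin b ≃ Node b (t + 1) where
  toFun p := child p.1 p.2
  invFun u := (Fin.init u, u (Fin.last t))
  left_inv p := by simp [child]
  right_inv u := by simp [child]

/-- A bit string on level `t + 1` is a family of bit strings on blocks of siblings. -/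
def registerEquiv (b t : ℕ) : (Node b (t + 1) → Fin 2) ≃ (Node b t → Fin b → Fin 2) :=
  ((childEquiv b t).arrowCongr (Equiv.refl _)).symm.trans (Equiv.curry _ _ _)

/-- Distributivity over sibling blocks: this reduces identities for `layer V t` to identities for a
single `V`. -/
lemma sum_register_prod (t : ℕ) (F : Node b t → (Fin b → Fin 2) → ℂ) :
    ∑ r : Node b (t + 1) → Fin 2, ∏ v, F v (fun c => r (child v c)) = ∏ v, ∑ x, F v x := by
  rw [Finset.prod_univ_sum, Fintype.piFinset_univ, ← (registerEquiv b t).sum_comp]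
  rfl

lemma prod_children {M : Type} [CommMonoid M] (t : ℕ) (F : Node b (t + 1) → M) :
    ∏ u, F u = ∏ v : Node b t, ∏ c, F (child v c) := by
  rw [← (childEquiv b t).prod_comp, Fintype.prod_prod_type]
  rfl

lemma sum_children {M : Type} [AddCommMonoid M] (t : ℕ) (F : Node b (t + 1) → M) :
    ∑ u, F u = ∑ v : Node b t, ∑ c, F (child v c) := by
  rw [← (childEquiv b t).sum_comp, Fintype.sum_prod_type]
  rfl

/-- The columns of the encoder are two columns of `U`, distinct because qubit 0 exists when `1 ≤ b`.
-/
lemma encoder_isometry (hb : 1 ≤ b) {U : Op (Fin b)}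
    (hU : U ∈ Matrix.unitaryGroup (Fin b → Fin 2) ℂ) : (encoder U)ᴴ * encoder U = 1 := by
  have h : Uᴴ * U = 1 := Matrix.mem_unitaryGroup_iff'.1 hU
  ext a a'
  have h' := congrFun (congrFun h (fun k : Fin b => if (k : ℕ) = 0 then a else 0))
    (fun k : Fin b => if (k : ℕ) = 0 then a' else 0)
  simp only [Matrix.mul_apply, conjTranspose_apply, encoder, of_apply] at h' ⊢
  rw [h', Matrix.one_apply, Matrix.one_apply]
  refine if_congr ⟨fun h => ?_, fun h => by rw [h]⟩ rfl rfl
  simpa using congrFun h ⟨0, hb⟩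

lemma layer_isometry {V : Matrix (Fin b → Fin 2) (Fin 2) ℂ} (hV : Vᴴ * V = 1) (t : ℕ) :
    (layer V t)ᴴ * layer V t = 1 := by
  ext s s'
  simp only [Matrix.mul_apply, conjTranspose_apply, layer, of_apply, star_prod,
    ← Finset.prod_mul_distrib]
  rw [sum_register_prod t fun v x => star (V x (s v)) * V x (s' v)]
  have : ∀ a a', ∑ x, star (V x a) * V x a' = (1 : Qubit) a a' := fun a a' => by
    rw [← hV]; rfl
  simp only [this, Matrix.one_apply]
  rw [Fintype.prod_boole]
  simp [funext_iff]

/-- The Pauli operator obtained from `Q` by replacing each factor `σ_v` by `L v`. -/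
def substitute (L : Axis → PauliOp (Fin b)) {t : ℕ} (Q : PauliOp (Node b t)) :
    PauliOp (Node b (t + 1)) :=
  ⟨Q.phase + ∑ v : Node b t, (extendLogical L (Q.label v)).phase,
    fun u => (extendLogical L (Q.label (Fin.init u))).label (u (Fin.last t))⟩

lemma substitute_label_child (L : Axis → PauliOp (Fin b)) {t : ℕ} (Q : PauliOp (Node b t))
    (v : Node b t) (c : Fin b) :
    (substitute L Q).label (child v c) = (extendLogical L (Q.label v)).label c := by
  simp [substitute, child]

lemma I_pow_val_add (m n : Fin 4) :
    Complex.I ^ ((m + n : Fin 4) : ℕ) = Complex.I ^ (m : ℕ) * Complex.I ^ (n : ℕ) := by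
  rw [Fin.val_add, ← pow_add, ← Complex.I_pow_eq_pow_mod]

lemma I_pow_val_sum {κ : Type} (s : Finset κ) (p : κ → Fin 4) :
    Complex.I ^ ((∑ i ∈ s, p i : Fin 4) : ℕ) = ∏ i ∈ s, Complex.I ^ (p i : ℕ) := by
  classical
  induction s using Finset.induction_on with
  | empty => simp
  | insert i s hi ih => rw [Finset.sum_insert hi, Finset.prod_insert hi, I_pow_val_add, ih]

lemma extendLogical_toOp_mul {V : Matrix (Fin b → Fin 2) (Fin 2) ℂ} {L : Axis → PauliOp (Fin b)}
    (hL : ∀ w, IsLogical V (L w) w) (l : Label) :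
    (extendLogical L l).toOp * V = V * labelOp l := by
  cases l with
  | none => simp [extendLogical, PauliOp.toOp_eq_smul, pauli_none, labelOp]
  | some w => exact hL w

/-- Concatenated Pauli operators intertwine with the encoding layers. -/
lemma substitute_toOp_mul_layer {V : Matrix (Fin b → Fin 2) (Fin 2) ℂ}
    {L : Axis → PauliOp (Fin b)} (hL : ∀ w, IsLogical V (L w) w) {t : ℕ}
    (Q : PauliOp (Node b t)) :
    (substitute L Q).toOp * layer V t = layer V t * Q.toOp := by
  ext r s
  -- The logical relation in one block, entry by entry; its product over all nodes is the claim up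
  -- to the phase of `Q`.
  have hleft : ∀ v : Node b t, ∑ x : Fin b → Fin 2,
      (Complex.I ^ ((extendLogical L (Q.label v)).phase : ℕ) *
        ∏ c, labelOp ((extendLogical L (Q.label v)).label c) (r (child v c)) (x c)) * V x (s v) =
      ∑ a, V (fun c => r (child v c)) a * labelOp (Q.label v) a (s v) := by
    intro v
    have := congrFun (congrFun (extendLogical_toOp_mul hL (Q.label v))
      (fun c => r (child v c))) (s v)
    simpa only [Matrix.mul_apply, PauliOp.toOp, of_apply] using this
  have hprod := Finset.prod_congr rfl fun v (_ : v ∈ Finset.univ) => hleft v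
  rw [← sum_register_prod, Finset.prod_univ_sum, Fintype.piFinset_univ] at hprod
  simp only [Matrix.mul_apply, PauliOp.toOp, of_apply, layer]
  refine Eq.trans ?_ ((congrArg (fun z => Complex.I ^ (Q.phase : ℕ) * z) hprod).trans ?_)
  swap
  · simp only [Finset.mul_sum, Finset.prod_mul_distrib]
    exact Finset.sum_congr rfl fun a _ => by ring
  simp only [Finset.mul_sum]
  refine Finset.sum_congr rfl fun x _ => ?_
  rw [prod_children]
  simp only [substitute_label_child, Finset.prod_mul_distrib]
  rw [substitute, I_pow_val_add, I_pow_val_sum]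
  ring

lemma layer_mul_pauli {V : Matrix (Fin b → Fin 2) (Fin 2) ℂ} {L : Axis → PauliOp (Fin b)}
    (hL : ∀ w, IsLogical V (L w) w) {t : ℕ} (f : Node b t → Label) (A : Op (Node b t)) :
    conjMap (layer V t) (conjMap (pauli f) A) =
      conjMap (pauli (substitute L ⟨0, f⟩).label) (conjMap (layer V t) A) := by
  have h := conjMap_mul (substitute L ⟨0, f⟩).toOp (layer V t) A
  rw [substitute_toOp_mul_layer hL, conjMap_mul, conjMap_toOp, conjMap_toOp] at h
  exact h

lemma root_isometry (V : Matrix (Fin b → Fin 2) (Fin 2) ℂ) :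
    (treeIsometry V 0)ᴴ * treeIsometry V 0 = 1 := by
  ext a a'
  simp only [Matrix.mul_apply, conjTranspose_apply, treeIsometry, of_apply]
  rw [← (Equiv.funUnique (Node b 0) (Fin 2)).symm.sum_comp]
  fin_cases a <;> fin_cases a' <;> simp

lemma pauli_mul_root (V : Matrix (Fin b → Fin 2) (Fin 2) ℂ) (l : Label) :
    pauli (fun _ : Node b 0 => l) * treeIsometry V 0 = treeIsometry V 0 * labelOp l := by
  ext r a
  simp only [Matrix.mul_apply, treeIsometry, of_apply, pauli, tens]
  rw [← (Equiv.funUnique (Node b 0) (Fin 2)).symm.sum_comp]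
  have hr : ∀ u, r u = r Fin.elim0 := fun u => by rw [Subsingleton.elim u Fin.elim0]
  simp [hr]

end Layer

/-! ### Weights of concatenated logical operators -/

section Weight

variable {b : ℕ} (L : Axis → PauliOp (Fin b))

/-- The semiring is arbitrary because the same recursion counts weights over `ℕ` and propagates
costs over `ℝ`. -/
lemma sum_label_eq_sum_count {ι M : Type} [Fintype ι] [Semiring M] (P : PauliOp ι) (c : Axis → M) :
    ∑ k, (P.label k).elim 0 c = ∑ w, c w * (P.count w : M) := by
  have h : ∀ l : Label, l.elim 0 c = ∑ w, if l = some w then c w else 0 := by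
    intro l
    cases l with
    | none => simp
    | some v => simp
  simp only [h, PauliOp.count, Finset.card_filter, Nat.cast_sum, Finset.mul_sum]
  rw [Finset.sum_comm]
  simp

lemma PauliOp.weight_eq_sum_count {ι : Type} [Fintype ι] (P : PauliOp ι) :
    P.weight = ∑ w, P.count w := by
  have h := sum_label_eq_sum_count P (fun _ => (1 : ℕ))
  simp only [one_mul, Nat.cast_id] at h
  rw [← h, PauliOp.weight, Finset.card_filter]
  refine Finset.sum_congr rfl fun k _ => ?_
  cases P.label k <;> simp

lemma sum_extendLogical_label {M : Type} [Semiring M] (c : Axis → M) (l : Label) :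
    ∑ k, ((extendLogical L l).label k).elim 0 c =
      l.elim 0 (c ᵥ* (transitionMatrix L).map (Nat.cast : ℕ → M)) := by
  cases l with
  | none => simp [extendLogical]
  | some v =>
    rw [sum_label_eq_sum_count]
    rfl

lemma sum_substitute_label {M : Type} [Semiring M] (c : Axis → M) {t : ℕ}
    (Q : PauliOp (Node b t)) :
    ∑ u, ((substitute L Q).label u).elim 0 c =
      ∑ v, (Q.label v).elim 0 (c ᵥ* (transitionMatrix L).map (Nat.cast : ℕ → M)) := by
  rw [sum_children]
  simp only [substitute_label_child, sum_extendLogical_label]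

/-- Removing the last substitution turns `c` into `c D`, so the induction needs every cost vector,
not just the constant 1 that yields the weight. -/
lemma sum_levelLogical_label (c : Axis → ℕ) (w : Axis) (T : ℕ) :
    ∑ u, ((levelLogical L w T).label u).elim 0 c = (c ᵥ* transitionMatrix L ^ T) w := by
  induction T generalizing c with
  | zero => simp [levelLogical]
  | succ T ih =>
    change ∑ u, ((substitute L (levelLogical L w T)).label u).elim 0 c = _
    rw [sum_substitute_label, ih, Matrix.vecMul_vecMul, pow_succ']
    rfl

lemma dotProduct_mulVec_single (T : ℕ) (w : Axis) :
    (fun _ : Axis => 1) ⬝ᵥ (transitionMatrix L ^ T *ᵥ Pi.single w 1) =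
      ((fun _ => 1) ᵥ* transitionMatrix L ^ T) w := by
  rw [Matrix.dotProduct_mulVec, dotProduct_single_one]

lemma vecMul_pow_le_gWeight (T : ℕ) (w : Axis) :
    ((fun _ => 1) ᵥ* transitionMatrix L ^ T) w ≤ gWeight L T := by
  rw [← dotProduct_mulVec_single]
  exact Finset.le_sup (f := fun w : Axis =>
    (fun _ : Axis => 1) ⬝ᵥ (transitionMatrix L ^ T *ᵥ Pi.single w 1)) (Finset.mem_univ w)

lemma levelLogical_weight_le (T : ℕ) (w : Axis) :
    (levelLogical L w T).weight ≤ gWeight L T := by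
  refine le_trans (le_of_eq ?_) (vecMul_pow_le_gWeight L T w)
  rw [← sum_levelLogical_label, PauliOp.weight, Finset.card_filter]
  refine Finset.sum_congr rfl fun k _ => ?_
  cases (levelLogical L w T).label k <;> simp

/-- Column `w` of the transition matrix sums to the weight of `L w`, so each step multiplies the
bound by at most `bMax L`. -/
lemma gWeight_le_bMax_pow (T : ℕ) : gWeight L T ≤ bMax L ^ T := by
  refine Finset.sup_le fun w hw => ?_
  rw [dotProduct_mulVec_single]
  clear hw
  induction T generalizing w with
  | zero => simp
  | succ T ih =>
    rw [pow_succ, ← Matrix.vecMul_vecMul, pow_succ]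
    calc _ = ∑ u, ((fun _ => 1) ᵥ* transitionMatrix L ^ T) u * (L w).count u := rfl
      _ ≤ ∑ u, bMax L ^ T * (L w).count u :=
        Finset.sum_le_sum fun u _ => Nat.mul_le_mul_right _ (ih u)
      _ = bMax L ^ T * (L w).weight := by rw [← Finset.mul_sum, PauliOp.weight_eq_sum_count]
      _ ≤ _ := Nat.mul_le_mul_left _
        (Finset.le_sup (f := fun w => (L w).weight) (Finset.mem_univ w))

end Weight

lemma levelLogical_isLogical {b : ℕ} {V : Matrix (Fin b → Fin 2) (Fin 2) ℂ}
    {L : Axis → PauliOp (Fin b)} (hL : ∀ w, IsLogical V (L w) w) (T : ℕ) (w : Axis) :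
    IsLogical (treeIsometry V T) (levelLogical L w T) w := by
  induction T with
  | zero =>
    have := pauli_mul_root V (some w)
    simpa [IsLogical, levelLogical, PauliOp.toOp_eq_smul, labelOp] using this
  | succ T ih =>
    change (substitute L (levelLogical L w T)).toOp * (layer V T * treeIsometry V T) =
      layer V T * treeIsometry V T * sigma w
    have ih' : (levelLogical L w T).toOp * treeIsometry V T = treeIsometry V T * sigma w := ih
    rw [← Matrix.mul_assoc, substitute_toOp_mul_layer hL, Matrix.mul_assoc, ih', Matrix.mul_assoc]

/-! ### Sensitivity of a channel to Pauli operators on its input -/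

section Sensitivity

variable {ι κ : Type} [Fintype ι] [DecidableEq ι] [Fintype κ]

/-- Conjugating the input of `R` by a Pauli operator changes the output by at most the sum of the
costs `c` of the nontrivial factors. -/
def SensitivityBound (R : Op ι →ₗ[ℂ] Matrix κ κ ℂ) (c : Axis → ℝ) : Prop :=
  ∀ (f : ι → Label) (A : Op ι), A.PosSemidef →
    HasTraceBound (R (conjMap (pauli f) A) - R A) ((∑ k, (f k).elim 0 c) * A.trace.re)

lemma trace_re_nonneg {A : Op ι} (hA : A.PosSemidef) : 0 ≤ A.trace.re :=
  (Complex.le_def.1 hA.trace_nonneg).1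

/-- Conjugation keeps positivity and trace, so the change never exceeds twice the trace; one
nontrivial factor already pays for that. -/
lemma sensitivityBound_id : SensitivityBound (LinearMap.id : Op ι →ₗ[ℂ] Op ι) (fun _ => 2) := by
  intro f A hA
  by_cases hf : ∀ k, f k = none
  · obtain rfl : f = fun _ => none := funext hf
    refine HasTraceBound.zero.congr ?_ (by simp)
    simp [pauli_none, conjMap_apply]
  · push Not at hf
    obtain ⟨k, hk⟩ := hf
    have h2 : (2 : ℝ) ≤ ∑ k, (f k).elim 0 fun _ => (2 : ℝ) := by
      have hle := Finset.single_le_sum (f := fun k => (f k).elim 0 fun _ => (2 : ℝ))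
        (fun i _ => by cases f i <;> simp) (Finset.mem_univ k)
      obtain ⟨w, hw⟩ := Option.ne_none_iff_exists'.1 hk
      simpa [hw] using hle
    refine (HasTraceBound.sub_of_posSemidef (conjMap_posSemidef (pauli f) hA) hA).mono ?_
    rw [conjMap_trace (pauli_conjTranspose_mul_self f)]
    nlinarith [trace_re_nonneg hA]

/-- Depolarizing noise before a channel reduces its sensitivity by the factor `1 - ε`. -/
lemma SensitivityBound.comp_noiseMap {R : Op ι →ₗ[ℂ] Matrix κ κ ℂ} {c : Axis → ℝ}
    (hR : SensitivityBound R c) {ε : ℝ} (hε0 : 0 ≤ ε) (hε1 : ε ≤ 1) :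
    SensitivityBound (R ∘ₗ noiseMap ε) ((1 - ε) • c) := by
  intro f A hA
  have hcost : ∀ l : Label, l.elim 0 ((1 - ε) • c) = (1 - ε) * l.elim 0 c := by
    intro l; cases l <;> simp
  -- Telescoping over sites: switching on the Pauli factors one by one lets the single-qubit
  -- attenuation act on each.
  have key : ∀ S : Finset ι, HasTraceBound
      ((R ∘ₗ noiseMap ε) (conjMap (pauli fun k => if k ∈ S then f k else none) A) -
        (R ∘ₗ noiseMap ε) A) ((∑ k ∈ S, (f k).elim 0 ((1 - ε) • c)) * A.trace.re) := by
    intro S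
    induction S using Finset.induction_on with
    | empty => exact HasTraceBound.zero.congr (by simp [pauli_none, conjMap_apply]) (by simp)
    | insert k S hk ih =>
      set g : ι → Label := fun k => if k ∈ S then f k else none with hg
      have hgk : g k = none := by simp [hg, hk]
      have hupd : (fun j => if j ∈ insert k S then f j else none) =
          Function.update g k (f k) := by
        ext1 j
        by_cases hj : j = k
        · subst hj; simp
        · simp [hj, hg]
      set B := conjMap (pauli g) A with hB
      have hBpos : B.PosSemidef := conjMap_posSemidef _ hA
      have hBtr : B.trace = A.trace := conjMap_trace (pauli_conjTranspose_mul_self g) A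
      obtain ⟨hYpos, hYtr⟩ := noiseOff_posSemidef_trace hε0 hε1 k hBpos
      have hstep := (hR (Function.update (fun _ => none) k (f k)) _ hYpos).smul
        (sub_nonneg.2 hε1)
      rw [← sitePauli, ← map_sub, ← map_smul, ← noiseMap_conjMap_sitePauli_sub, hYtr, hBtr] at hstep
      refine (hstep.add ih).congr ?_ ?_
      · rw [hupd, pauli_update_mul g k (f k) hgk, conjMap_mul, ← hB, ← sitePauli]
        simp only [LinearMap.comp_apply, map_sub]
        abel
      · have hsum : ∑ j, (Function.update (fun _ => none) k (f k) j : Label).elim 0 c =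
            (f k).elim 0 c := by
          rw [Finset.sum_eq_single k]
          · simp
          · intro j _ hj; simp [hj]
          · simp
        rw [hsum, Finset.sum_insert hk, hcost]
        ring
  simpa using key Finset.univ

/-- Encoding before a channel propagates sensitivities along the transition matrix. -/
lemma SensitivityBound.comp_layer {b t : ℕ} {V : Matrix (Fin b → Fin 2) (Fin 2) ℂ}
    (hV : Vᴴ * V = 1) {L : Axis → PauliOp (Fin b)} (hL : ∀ w, IsLogical V (L w) w)
    {R : Op (Node b (t + 1)) →ₗ[ℂ] Matrix κ κ ℂ} {c : Axis → ℝ} (hR : SensitivityBound R c) :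
    SensitivityBound (R ∘ₗ conjMap (layer V t))
      (c ᵥ* (transitionMatrix L).map (Nat.cast : ℕ → ℝ)) := by
  intro f A hA
  -- The phase 0 is an arbitrary choice, since conjugation ignores it.
  have h := hR (substitute L ⟨0, f⟩).label _ (conjMap_posSemidef (layer V t) hA)
  rw [← layer_mul_pauli hL, conjMap_trace (layer_isometry hV t), sum_substitute_label] at h
  exact h

end Sensitivity

/-! ### The tree channel -/

section Tree

variable {b : ℕ}

/-- The tree channel with depolarizing noise as a linear map. -/
def treeMap (V : Matrix (Fin b → Fin 2) (Fin 2) ℂ) (ε : ℝ) : (T : ℕ) → Qubit →ₗ[ℂ] Op (Node b T)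
  | 0 => conjMap (treeIsometry V 0)
  | T + 1 => noiseMap ε ∘ₗ conjMap (layer V T) ∘ₗ treeMap V ε T

lemma treeChannel_eq_treeMap (V : Matrix (Fin b → Fin 2) (Fin 2) ℂ) (ε : ℝ) (T : ℕ) (ρ : Qubit) :
    treeChannel V (depolarizing ε) T ρ = treeMap V ε T ρ := by
  induction T with
  | zero =>
    ext r s
    simp [treeChannel, treeMap, conjMap_apply, Matrix.mul_apply, treeIsometry,
      conjTranspose_apply, apply_ite]
  | succ T ih =>
    rw [treeChannel, ih, tensorPower_depolarizing]
    rfl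

lemma treeMap_posSemidef_trace {V : Matrix (Fin b → Fin 2) (Fin 2) ℂ} (hV : Vᴴ * V = 1) {ε : ℝ}
    (hε0 : 0 ≤ ε) (hε1 : ε ≤ 1) (T : ℕ) {ρ : Qubit} (hρ : ρ.PosSemidef) :
    (treeMap V ε T ρ).PosSemidef ∧ (treeMap V ε T ρ).trace = ρ.trace := by
  induction T with
  | zero => exact ⟨conjMap_posSemidef _ hρ, conjMap_trace (root_isometry V) ρ⟩
  | succ T ih =>
    obtain ⟨h1, h2⟩ := noiseMap_posSemidef_trace hε0 hε1 (conjMap_posSemidef (layer V T) ih.1)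
    exact ⟨h1, h2.trans ((conjMap_trace (layer_isometry hV T) _).trans ih.2)⟩

/-- `R` stands for the part of the tree below level `T`. The induction moves the lowest noise and
encoding layers into `R`, so it must range over all `R` and `c`. -/
lemma treeMap_conj_sigma_bound {V : Matrix (Fin b → Fin 2) (Fin 2) ℂ} (hV : Vᴴ * V = 1)
    {L : Axis → PauliOp (Fin b)} (hL : ∀ w, IsLogical V (L w) w) {ε : ℝ}
    (hε0 : 0 ≤ ε) (hε1 : ε ≤ 1) {ρ : Qubit} (hρ : ρ.PosSemidef) (w : Axis) (T : ℕ)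
    {κ : Type} [Fintype κ] (R : Op (Node b T) →ₗ[ℂ] Matrix κ κ ℂ) (c : Axis → ℝ)
    (hR : SensitivityBound R c) :
    HasTraceBound (R (treeMap V ε T (conjMap (sigma w) ρ)) - R (treeMap V ε T ρ))
      ((1 - ε) ^ T * (c ᵥ* (transitionMatrix L).map (Nat.cast : ℕ → ℝ) ^ T) w * ρ.trace.re) := by
  induction T generalizing c with
  | zero =>
    have h := hR (fun _ => some w) _ (conjMap_posSemidef (treeIsometry V 0) hρ)
    rw [← conjMap_mul, pauli_mul_root, conjMap_mul, conjMap_trace (root_isometry V)] at h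
    exact h.congr rfl (by simp)
  | succ T ih =>
    refine (ih ((R ∘ₗ noiseMap ε) ∘ₗ conjMap (layer V T)) _
      ((hR.comp_noiseMap hε0 hε1).comp_layer hV hL)).congr rfl ?_
    rw [Matrix.vecMul_vecMul, ← pow_succ', Matrix.smul_vecMul, Pi.smul_apply, smul_eq_mul]
    ring

/-- This is the Pauli mixture at `ε = 1`, where all four errors have probability `1/4`. -/
lemma maxMixed_eq_average {ρ : Qubit} (hρ : ρ.trace = 1) :
    maxMixed = (1 / 4 : ℂ) • (ρ + ∑ w, conjMap (sigma w) ρ) := by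
  have h := depolarizing_eq_sum 1 ρ
  rw [Fintype.sum_option] at h
  have h' : depolarizing 1 ρ = maxMixed := by
    simp [depolarizing, hρ, maxMixed]
  rw [h'] at h
  rw [h, smul_add, Finset.smul_sum]
  congr 1
  · simp only [errorProb, labelOp, Matrix.one_mul, conjTranspose_one, Matrix.mul_one]
    norm_num
  · refine Finset.sum_congr rfl fun w _ => ?_
    simp [errorProb, labelOp, conjMap_apply]

lemma treeMap_sub_maxMixed_bound {V : Matrix (Fin b → Fin 2) (Fin 2) ℂ} (hV : Vᴴ * V = 1)
    {L : Axis → PauliOp (Fin b)} (hL : ∀ w, IsLogical V (L w) w) {ε : ℝ}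
    (hε0 : 0 ≤ ε) (hε1 : ε ≤ 1) (T : ℕ) {ρ : Qubit} (hρ : IsDensity ρ) :
    HasTraceBound (treeMap V ε T ρ - treeMap V ε T maxMixed)
      (3 / 2 * (gWeight L T * (1 - ε) ^ T)) := by
  have hw : ∀ w : Axis, HasTraceBound
      (treeMap V ε T ρ - treeMap V ε T (conjMap (sigma w) ρ))
      (2 * (gWeight L T * (1 - ε) ^ T)) := by
    intro w
    have h := (treeMap_conj_sigma_bound hV hL hε0 hε1 hρ.1 w T LinearMap.id _
      sensitivityBound_id).neg
    refine HasTraceBound.mono (h.congr (by simp) rfl) ?_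
    have hcast : ((fun _ => (2 : ℝ)) ᵥ* (transitionMatrix L).map (Nat.cast : ℕ → ℝ) ^ T) w =
        2 * ((((fun _ => 1) ᵥ* transitionMatrix L ^ T) w : ℕ) : ℝ) := by
      have hpow : (transitionMatrix L).map (Nat.cast : ℕ → ℝ) ^ T =
          (transitionMatrix L ^ T).map (Nat.cast : ℕ → ℝ) :=
        (map_pow (Nat.castRingHom ℝ).mapMatrix (transitionMatrix L) T).symm
      rw [hpow]
      simp [Matrix.vecMul, dotProduct, Finset.mul_sum]
    rw [hcast, hρ.2]
    have hle : ((((fun _ => 1) ᵥ* transitionMatrix L ^ T) w : ℕ) : ℝ) ≤ gWeight L T := by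
      exact_mod_cast vecMul_pow_le_gWeight L T w
    have hq : (0 : ℝ) ≤ (1 - ε) ^ T := pow_nonneg (sub_nonneg.2 hε1) T
    simp only [Complex.one_re]
    nlinarith [mul_le_mul_of_nonneg_right hle hq]
  -- The identity term of the average contributes nothing, so three terms of weight `1/4` and bound
  -- `2x` give `3x/2`.
  have hsum := (HasTraceBound.sum Finset.univ fun w _ => hw w).smul (a := 1 / 4) (by norm_num)
  refine hsum.congr ?_ ?_
  · rw [maxMixed_eq_average hρ.2]
    have hcard : Fintype.card Axis = 3 := rfl
    simp only [map_smul, map_add, map_sum, Finset.sum_sub_distrib, Finset.sum_const,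
      Finset.card_univ, hcard]
    push_cast
    module
  · have hcard : Fintype.card Axis = 3 := rfl
    simp only [Finset.sum_const, Finset.card_univ, hcard]
    norm_num
    ring

/-- The distance of two outputs of the tree channel, for arbitrary inputs. -/
lemma treeMap_sub_bound {V : Matrix (Fin b → Fin 2) (Fin 2) ℂ} (hV : Vᴴ * V = 1)
    {L : Axis → PauliOp (Fin b)} (hL : ∀ w, IsLogical V (L w) w) {ε : ℝ}
    (hε0 : 0 ≤ ε) (hε1 : ε ≤ 1) (T : ℕ) {ρ ρ' : Qubit} (hρ : IsDensity ρ) (hρ' : IsDensity ρ') :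
    HasTraceBound (treeMap V ε T ρ - treeMap V ε T ρ') (3 * (gWeight L T * (1 - ε) ^ T)) :=
  ((treeMap_sub_maxMixed_bound hV hL hε0 hε1 T hρ).add
    (treeMap_sub_maxMixed_bound hV hL hε0 hε1 T hρ').neg).congr (by abel) (by ring)

lemma maxMixed_isDensity : IsDensity maxMixed := by
  refine ⟨PosSemidef.one.smul ?_, ?_⟩
  · rw [Complex.le_def]; norm_num
  · simp [maxMixed]

lemma traceNorm_treeMap_sub_maxMixed_le {V : Matrix (Fin b → Fin 2) (Fin 2) ℂ} (hV : Vᴴ * V = 1)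
    {L : Axis → PauliOp (Fin b)} (hL : ∀ w, IsLogical V (L w) w) {ε : ℝ}
    (hε0 : 0 ≤ ε) (hε1 : ε ≤ 1) (T : ℕ) {ρ : Qubit} (hρ : IsDensity ρ) :
    traceNorm (treeMap V ε T ρ - treeMap V ε T maxMixed) ≤
      2 * √2 * √((gWeight L T : ℝ) * (1 - ε) ^ T) := by
  have h1 := (treeMap_sub_maxMixed_bound hV hL hε0 hε1 T hρ).traceNorm_le
  obtain ⟨hP, hPtr⟩ := treeMap_posSemidef_trace hV hε0 hε1 T hρ.1
  obtain ⟨hN, hNtr⟩ := treeMap_posSemidef_trace hV hε0 hε1 T maxMixed_isDensity.1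
  have h2 := (HasTraceBound.sub_of_posSemidef hP hN).traceNorm_le
  rw [hPtr, hNtr, hρ.2, maxMixed_isDensity.2, Complex.one_re] at h2
  have hx : 0 ≤ (gWeight L T : ℝ) * (1 - ε) ^ T :=
    mul_nonneg (Nat.cast_nonneg _) (pow_nonneg (sub_nonneg.2 hε1) T)
  set x := (gWeight L T : ℝ) * (1 - ε) ^ T
  have hs2 : 1 ≤ √2 := Real.one_le_sqrt.2 (by norm_num)
  have hsq := Real.sq_sqrt hx
  have hs0 := Real.sqrt_nonneg x
  -- For `x ≤ 1` use `3x/2 ≤ (3/2)√x`; for `x ≥ 1` the trivial bound 2 suffices.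
  rcases le_total (√x) 1 with hs | hs <;> nlinarith

end Tree

/-! ### The threshold -/

section Threshold

variable {b : ℕ} (L : Axis → PauliOp (Fin b))

open Filter Topology

lemma tendsto_gWeight_mul_pow_of_bMax {q : ℝ} (hq : 0 ≤ q) (h : q * bMax L < 1) :
    Tendsto (fun T : ℕ => (gWeight L T : ℝ) * q ^ T) atTop (𝓝 0) := by
  refine squeeze_zero (fun T => by positivity) (fun T => ?_)
    (tendsto_pow_atTop_nhds_zero_of_lt_one (mul_nonneg hq (Nat.cast_nonneg (bMax L))) h)
  rw [mul_pow, mul_comm]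
  exact mul_le_mul_of_nonneg_left (by exact_mod_cast gWeight_le_bMax_pow L T) (pow_nonneg hq T)

attribute [local instance] Matrix.linftyOpNormedRing Matrix.linftyOpNormedAlgebra

/-- The norm is the largest absolute row sum, so it dominates every entry; a column has three
entries. -/
lemma gWeight_le_norm_pow (T : ℕ) :
    (gWeight L T : ℝ) ≤ 3 * ‖(transitionMatrix L).map (Nat.cast : ℕ → ℂ) ^ T‖ := by
  have hpow : (transitionMatrix L).map (Nat.cast : ℕ → ℂ) ^ T =
      (transitionMatrix L ^ T).map (Nat.cast : ℕ → ℂ) :=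
    (map_pow (Nat.castRingHom ℂ).mapMatrix (transitionMatrix L) T).symm
  rw [hpow]
  set M := transitionMatrix L ^ T with hM
  have hentry : ∀ u w : Axis, (M u w : ℝ) ≤ ‖M.map (Nat.cast : ℕ → ℂ)‖ := by
    intro u w
    rw [Matrix.linfty_opNorm_def]
    have h1 : ‖M.map (Nat.cast : ℕ → ℂ) u w‖₊ ≤ ∑ j, ‖M.map (Nat.cast : ℕ → ℂ) u j‖₊ :=
      Finset.single_le_sum (f := fun j => ‖M.map (Nat.cast : ℕ → ℂ) u j‖₊)
        (fun _ _ => zero_le) (Finset.mem_univ w)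
    have h2 := Finset.le_sup (f := fun i => ∑ j, ‖M.map (Nat.cast : ℕ → ℂ) i j‖₊)
      (Finset.mem_univ u)
    have h3 : ((‖M.map (Nat.cast : ℕ → ℂ) u w‖₊ : NNReal) : ℝ) = M u w := by simp
    rw [← h3]
    exact_mod_cast h1.trans h2
  obtain ⟨w, -, hw⟩ := Finset.exists_mem_eq_sup Finset.univ ⟨Axis.x, Finset.mem_univ _⟩
    (fun w : Axis => (fun _ : Axis => 1) ⬝ᵥ (transitionMatrix L ^ T *ᵥ Pi.single w 1))
  rw [gWeight, hw, dotProduct_mulVec_single, ← hM]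
  have hsum : (((fun _ => 1) ᵥ* M) w : ℕ) = ∑ u, M u w := by simp [Matrix.vecMul, dotProduct]
  rw [hsum]
  push_cast
  calc ∑ u, (M u w : ℝ) ≤ ∑ _u : Axis, ‖M.map (Nat.cast : ℕ → ℂ)‖ :=
        Finset.sum_le_sum fun u _ => hentry u w
    _ = _ := by
      have hcard : Fintype.card Axis = 3 := rfl
      simp [hcard]

/-- By Gelfand's formula `‖D^n‖^(1/n)` tends to the spectral radius, so `q^n ‖D^n‖` is eventually at
most `s^n` for any `s` strictly between `q * lambdaMax L` and 1. -/
lemma tendsto_gWeight_mul_pow_of_lambdaMax {q : ℝ} (hq : 0 ≤ q) (h : q * lambdaMax L < 1) :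
    Tendsto (fun T : ℕ => (gWeight L T : ℝ) * q ^ T) atTop (𝓝 0) := by
  set D := (transitionMatrix L).map (Nat.cast : ℕ → ℂ) with hD
  have : Nonempty Axis := ⟨Axis.x⟩
  have : CompleteSpace (Matrix Axis Axis ℂ) := FiniteDimensional.complete ℂ _
  have hlim := spectrum.pow_norm_pow_one_div_tendsto_nhds_spectralRadius D
  have hfin : spectralRadius ℂ D ≠ ⊤ :=
    ((spectrum.spectralRadius_le_nnnorm D).trans_lt ENNReal.coe_lt_top).ne
  have hlim' : Tendsto (fun n : ℕ => ‖D ^ n‖ ^ (1 / n : ℝ)) atTop (𝓝 (lambdaMax L)) := by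
    refine ((ENNReal.tendsto_toReal hfin).comp hlim).congr fun n => ?_
    simp only [Function.comp_apply]
    rw [ENNReal.toReal_ofReal (by positivity)]
  have hlim2 := hlim'.const_mul q
  obtain ⟨s, hs1, hs2⟩ := exists_between h
  have hlam : 0 ≤ lambdaMax L := ENNReal.toReal_nonneg
  have hs0 : 0 ≤ s := (mul_nonneg hq hlam).trans hs1.le
  have hev : ∀ᶠ n : ℕ in atTop, (gWeight L n : ℝ) * q ^ n ≤ 3 * s ^ n := by
    filter_upwards [hlim2.eventually_lt_const hs1, eventually_ge_atTop 1] with n hn hn1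
    have hroot : (‖D ^ n‖ ^ (1 / n : ℝ)) ^ n = ‖D ^ n‖ := by
      rw [one_div]
      exact Real.rpow_inv_natCast_pow (norm_nonneg _) (by omega)
    have hpow : (q * ‖D ^ n‖ ^ (1 / n : ℝ)) ^ n ≤ s ^ n :=
      pow_le_pow_left₀ (by positivity) hn.le n
    rw [mul_pow, hroot] at hpow
    have := mul_le_mul_of_nonneg_right (gWeight_le_norm_pow L n) (pow_nonneg hq n)
    rw [← hD] at this
    linarith
  refine squeeze_zero' (Eventually.of_forall fun T => by positivity) hev ?_
  simpa using (tendsto_pow_atTop_nhds_zero_of_lt_one hs0 hs2).const_mul 3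

end Threshold

end NoisyTree

end

open NoisyTree
theorem proposition3 (b : ℕ) (hb : 1 ≤ b)
    (U : Op (Fin b)) (hU : IsClifford U)
    (L : Axis → PauliOp (Fin b)) (hL : ∀ w, IsLogical (encoder U) (L w) w)
    (ε : ℝ) (hε0 : 0 ≤ ε) (hε1 : ε ≤ 1) :
    -- the bound on the trace distance
    (∀ (T : ℕ) (ρ : Qubit), IsDensity ρ →
      traceNorm (treeChannel (encoder U) (depolarizing ε) T ρ
          - treeChannel (encoder U) (depolarizing ε) T maxMixed)
        ≤ 2 * √2 * √((gWeight L T : ℝ) * (1 - ε) ^ T)) ∧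
    -- `g(T)` bounds the weights of the logical operators at level `T`, and is at most `b_max ^ T`
    (∀ (T : ℕ) (w : Axis),
      IsLogical (treeIsometry (encoder U) T) (levelLogical L w T) w ∧
        (levelLogical L w T).weight ≤ gWeight L T) ∧
    (∀ T : ℕ, gWeight L T ≤ bMax L ^ T) ∧
    -- above the noise threshold the output becomes independent of the input, uniformly
    ((1 - ε) * min (lambdaMax L) (bMax L : ℝ) < 1 →
      ∀ δ : ℝ, 0 < δ → ∃ T₀ : ℕ, ∀ T : ℕ, T₀ ≤ T → ∀ ρ ρ' : Qubit, IsDensity ρ → IsDensity ρ' →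
        traceNorm (treeChannel (encoder U) (depolarizing ε) T ρ
          - treeChannel (encoder U) (depolarizing ε) T ρ') < δ) := by
  have hV := encoder_isometry hb hU.1
  have hq : 0 ≤ 1 - ε := sub_nonneg.2 hε1
  simp only [treeChannel_eq_treeMap]
  refine ⟨fun T ρ hρ => traceNorm_treeMap_sub_maxMixed_le hV hL hε0 hε1 T hρ,
    fun T w => ⟨levelLogical_isLogical hL T w, levelLogical_weight_le L T w⟩,
    gWeight_le_bMax_pow L, fun h δ hδ => ?_⟩
  have hlim : Filter.Tendsto (fun T : ℕ => (gWeight L T : ℝ) * (1 - ε) ^ T) Filter.atTop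
      (nhds 0) := by
    rcases min_choice (lambdaMax L) (bMax L : ℝ) with hmin | hmin <;> rw [hmin] at h
    · exact tendsto_gWeight_mul_pow_of_lambdaMax L hq h
    · exact tendsto_gWeight_mul_pow_of_bMax L hq h
  obtain ⟨T₀, hT₀⟩ := Filter.eventually_atTop.1
    -- The divisor 3 is the constant in `treeMap_sub_bound`: `3/2` for each input, compared through
    -- `maxMixed`.
    (hlim.eventually_lt_const (show (0 : ℝ) < δ / 3 by positivity))
  refine ⟨T₀, fun T hT ρ ρ' hρ hρ' => ?_⟩
  refine (treeMap_sub_bound hV hL hε0 hε1 T hρ hρ').traceNorm_le.trans_lt ?_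
  linarith [hT₀ T hT]
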